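/- An argumentation framework (AF) is a pair $F=(A_F,R_F)$ of a set $A_F$ (possibly infinite) and a relation $R_F\subseteq A_F\times A_F$; we say that $a$ attacks $b$ if $(a,b)\in R_F$. For $S\subseteq A_F$ let $F{\restriction}_S=(S,\,R_F\cap(S\times S))$, and let $S^{\oplus}=S\cup\{x\in A_F:\text{ some } y\in S \text{ attacks } x\}$. $F$ is finitary if every argument has only finitely many attackers. A set $S\subseteq A_F$ is conflict-free in $F$ if no element of $S$ attacks an element of $S$. A conflict-free set $S$ is a naive extension of $F$ if no conflict-free set $T$ satisfies $S\subsetneq T$, and a stage extension of $F$ if no conflict-free set $T$ satisfies $S^{\oplus}\subsetneq T^{\oplus}$ (ranges taken in $F$). The strongly connected component of $a\in A_F$ is the set of all $b\in A_F$ for which there are directed paths of attacks, possibly of length $0$, from $a$ to $b$ and from $b$ to $a$; $\mathrm{SCC}(F)$ is the set of strongly connected components of $F$. For $S,X\subseteq A_F$ let $D_S(X)=\{b\in X:\text{ some } a\in S\setminus X \text{ attacks } b\}$. A conflict-free set $S\subseteq A_F$ belongs to $\mathrm{cf1.5}(F)$ if for each $X\in\mathrm{SCC}(F)$ the set $S\cap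 X$ is a naive extension of $F{\restriction}_{X\setminus D_S(X)}$; it belongs to $\mathrm{stg1.5}(F)$ if for each $X\in\mathrm{SCC}(F)$ the set $S\cap X$ is a stage extension of $F{\restriction}_{X\setminus D_S(X)}$. **Theorem.** The semantics $\mathrm{cf1.5}$ and $\mathrm{stg1.5}$ satisfy finitary directionality: for $\sigma\in\{\mathrm{cf1.5},\mathrm{stg1.5}\}$, for every finitary AF $F$ and every $U\subseteq A_F$ such that no argument in $A_F\setminus U$ attacks an argument in $U$, $$\sigma(F{\restriction}_U)=\{S\cap U : S\in\sigma(F)\}.$$ -/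

import Mathlib

universe u

/-- An argumentation framework: a set `args` of arguments (inside an ambient type `α`) and
an attack relation on it; `F.att a b` says that `a` attacks `b`. -/
structure AF (α : Type u) where
  args : Set α
  att : α → α → Prop
  left_mem : ∀ {a b : α}, att a b → a ∈ args
  right_mem : ∀ {a b : α}, att a b → b ∈ args

namespace AF

variable {α : Type u}

/-- The sub-framework of `F` induced on `S`. -/
def restrict (F : AF α) (S : Set α) : AF α where
  args := F.args ∩ S
  att a b := F.att a b ∧ a ∈ S ∧ b ∈ S
  left_mem h := ⟨F.left_mem h.1, h.2.1⟩
  right_mem h := ⟨F.right_mem h.1, h.2.2⟩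

/-- `S⁺`, the arguments attacked by `S`. -/
def plus (F : AF α) (S : Set α) : Set α := {x | ∃ y ∈ S, F.att y x}

/-- `S⁻`, the arguments that attack `S`. -/
def minus (F : AF α) (S : Set α) : Set α := {x | ∃ y ∈ S, F.att x y}

/-- The range of `S`, that is `S ∪ S⁺`. -/
def range (F : AF α) (S : Set α) : Set α := S ∪ F.plus S

/-- Every argument has only finitely many attackers. -/
def Finitary (F : AF α) : Prop := ∀ x ∈ F.args, (F.minus {x}).Finite

/-- No argument outside `U` attacks an argument in `U`. -/
def Unattacked (F : AF α) (U : Set α) : Prop :=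
  ∀ a ∈ F.args, a ∉ U → ∀ b ∈ U, ¬ F.att a b

/-- There is a directed path (possibly of length `0`) from `a` to `b`. -/
def Reach (F : AF α) (a b : α) : Prop := Relation.ReflTransGen F.att a b

/-- The strongly connected component of `a`. -/
def scc (F : AF α) (a : α) : Set α := {b ∈ F.args | F.Reach a b ∧ F.Reach b a}

/-- The set of strongly connected components of `F`. -/
def SCCs (F : AF α) : Set (Set α) := {X | ∃ a ∈ F.args, X = F.scc a}

/-- The elements of `X` that are attacked by an element of `S` outside `X`. -/
def D (F : AF α) (S X : Set α) : Set α := {b ∈ X | ∃ a ∈ S \ X, F.att a b}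

end AF

/-- A semantics assigns to every argumentation framework a set of sets of arguments. -/
def Semantics : Type (u + 1) := ∀ {α : Type u}, AF α → Set (Set α)

/-- Conflict-free sets of arguments. -/
def cf : Semantics.{u} := fun F =>
  {S | S ⊆ F.args ∧ ∀ a ∈ S, ∀ b ∈ S, ¬ F.att a b}

/-- Naive extensions: the conflict-free sets that are maximal under inclusion. -/
def naive : Semantics.{u} := fun F =>
  {S | S ∈ cf F ∧ ¬ ∃ T ∈ cf F, S ⊂ T}

/-- Stage extensions: the conflict-free sets whose range is maximal under inclusion. -/
def stage : Semantics.{u} := fun F =>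
  {S | S ∈ cf F ∧ ¬ ∃ T ∈ cf F, F.range S ⊂ F.range T}

/-- The semantics cf1.5. -/
def cf15 : Semantics.{u} := fun F =>
  {S | S ∈ cf F ∧ ∀ X ∈ F.SCCs, S ∩ X ∈ naive (F.restrict (X \ F.D S X))}

/-- The semantics stg1.5. -/
def stg15 : Semantics.{u} := fun F =>
  {S | S ∈ cf F ∧ ∀ X ∈ F.SCCs, S ∩ X ∈ stage (F.restrict (X \ F.D S X))}

/-- Finitary directionality: for every finitary `F` and every set `U` of arguments that is not
attacked from outside `U`, the extensions of the restriction of `F` to `U` are exactly the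
intersections with `U` of the extensions of `F`. -/
def FinitaryDirectionality (σ : Semantics.{u}) : Prop :=
  ∀ (α : Type u) (F : AF α), F.Finitary → ∀ U : Set α, U ⊆ F.args → F.Unattacked U →
    σ (F.restrict U) = {T | ∃ S ∈ σ F, T = S ∩ U}

/-!
Attacks into an unattacked set `U` never come from outside, so every strongly connected component
lies inside `U` or off `U`, and the condition imposed on a component inside `U` is the same in `F`
and in the restriction to `U`. The only real task is to extend a given `T ⊆ U` to the components
off `U`. Since stage extensions are naive, it suffices to do this with stage extensions on all
of these components; this serves both semantics (`AF.exists_extension`).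

The condensation of an infinite framework need not be well-founded, so the components cannot be
treated one after the other. The extension is obtained by compactness instead. Being a stage
extension is not a closed condition on `S`, but it follows from a closed one. In a finitary
framework a component `X` is countable; fix an injection `e : X → ℕ` and require that the range of
`S ∩ X` is lexicographically maximal with respect to `e` (`AF.LexMaximal`). Whether an argument is
in the range is decided by finitely many arguments, hence the requirement, cut off at a bound `n`,
passes to pointwise limits (`AF.lexMaximal_of_finite_agree`). For finitely many components and a
bound `n` it can be met by treating the components in topological order
(`AF.exists_finite_extension`), and an ultrafilter limit of these partial solutions satisfies all
requirements at once.
-/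

namespace AF

variable {α : Type u}

/-! ### Strongly connected components and unattacked sets -/

theorem Unattacked.mem_of_att {F : AF α} {U : Set α} (h : F.Unattacked U) {a b : α}
    (hab : F.att a b) (hb : b ∈ U) : a ∈ U := by
  by_contra ha
  exact h a (F.left_mem hab) ha b hb hab

theorem Unattacked.mem_of_reach {F : AF α} {U : Set α} (h : F.Unattacked U) {a b : α}
    (hab : F.Reach a b) (hb : b ∈ U) : a ∈ U := by
  induction hab using Relation.ReflTransGen.head_induction_on with
  | refl => exact hb
  | head hac _ ih => exact h.mem_of_att hac ih

theorem Unattacked.reach_restrict_iff {F : AF α} {U : Set α} (h : F.Unattacked U) {a b : α}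
    (hb : b ∈ U) : (F.restrict U).Reach a b ↔ F.Reach a b := by
  constructor
  · intro hab
    exact Relation.ReflTransGen.mono (fun _ _ hxy => And.left hxy) _ _ hab
  · intro hab
    induction hab using Relation.ReflTransGen.head_induction_on with
    | refl => exact .refl
    | head hac hcb ih =>
      have hc := h.mem_of_reach hcb hb
      exact .head ⟨hac, h.mem_of_att hac hc, hc⟩ ih

theorem Unattacked.scc_subset {F : AF α} {U : Set α} (h : F.Unattacked U) {a : α} (ha : a ∈ U) :
    F.scc a ⊆ U :=
  fun _ hb => h.mem_of_reach hb.2.2 ha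

theorem Unattacked.notMem_of_mem_scc {F : AF α} {U : Set α} (h : F.Unattacked U) {a b : α}
    (ha : a ∉ U) (hb : b ∈ F.scc a) : b ∉ U :=
  fun hbU => ha (h.mem_of_reach hb.2.1 hbU)

theorem Unattacked.scc_restrict {F : AF α} {U : Set α} (h : F.Unattacked U) {a : α}
    (ha : a ∈ U) : (F.restrict U).scc a = F.scc a := by
  ext b
  constructor
  · rintro ⟨hb, hab, hba⟩
    exact ⟨hb.1, (h.reach_restrict_iff hb.2).1 hab, (h.reach_restrict_iff ha).1 hba⟩
  · rintro ⟨hb, hab, hba⟩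
    have hbU := h.mem_of_reach hba ha
    exact ⟨⟨hb, hbU⟩, (h.reach_restrict_iff hbU).2 hab, (h.reach_restrict_iff ha).2 hba⟩

theorem restrict_restrict (F : AF α) {U V : Set α} (h : V ⊆ U) :
    (F.restrict U).restrict V = F.restrict V := by
  have h1 : F.args ∩ U ∩ V = F.args ∩ V := by
    rw [Set.inter_assoc, Set.inter_eq_right.2 h]
  have h2 : (fun a b => (F.att a b ∧ a ∈ U ∧ b ∈ U) ∧ a ∈ V ∧ b ∈ V) =
      fun a b => F.att a b ∧ a ∈ V ∧ b ∈ V := by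
    funext a b
    exact propext ⟨fun h' => ⟨h'.1.1, h'.2⟩, fun h' => ⟨⟨h'.1, h h'.2.1, h h'.2.2⟩, h'.2⟩⟩
  unfold restrict
  congr 1

/-- Inside an unattacked set, the part of a component attacked from outside the component does not
depend on whether it is computed in `F` or in the restriction. -/
theorem Unattacked.D_restrict {F : AF α} {U : Set α} (h : F.Unattacked U) (S : Set α)
    {X : Set α} (hX : X ⊆ U) : (F.restrict U).D (S ∩ U) X = F.D S X := by
  ext b
  constructor
  · rintro ⟨hb, a, ⟨ha, haX⟩, hab⟩
    exact ⟨hb, a, ⟨ha.1, haX⟩, hab.1⟩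
  · rintro ⟨hb, a, ⟨ha, haX⟩, hab⟩
    have haU := h.mem_of_att hab (hX hb)
    exact ⟨hb, a, ⟨⟨ha, haU⟩, haX⟩, hab, haU, hX hb⟩

/-- In a finitary framework, the arguments from which a given one can be reached are countable. -/
theorem Finitary.countable_reach {F : AF α} (hF : F.Finitary) (a : α) :
    {b | F.Reach b a}.Countable := by
  have key : ∀ n : ℕ, ((F.minus)^[n] {a}).Countable := by
    intro n
    induction n with
    | zero => simp
    | succ n ih =>
      rw [Function.iterate_succ_apply']
      refine (ih.biUnion fun x _ => ?_ : (⋃ x ∈ (F.minus)^[n] {a}, F.minus {x}).Countable).mono ?_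
      · by_cases hx : x ∈ F.args
        · exact (hF x hx).countable
        · refine Set.countable_empty.mono ?_
          rintro y ⟨z, rfl, hyz⟩
          exact hx (F.right_mem hyz)
      · rintro y ⟨x, hx, hyx⟩
        exact Set.mem_biUnion hx ⟨x, rfl, hyx⟩
  refine (Set.countable_iUnion key).mono fun b hb => ?_
  rw [Set.mem_iUnion]
  induction (show F.Reach b a from hb) using Relation.ReflTransGen.head_induction_on with
  | refl => exact ⟨0, rfl⟩
  | head hbc hca ih =>
    obtain ⟨n, hn⟩ := ih hca
    exact ⟨n + 1, by rw [Function.iterate_succ_apply']; exact ⟨_, hn, hbc⟩⟩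

theorem Finitary.exists_injOn_scc {F : AF α} (hF : F.Finitary) (a : α) :
    ∃ e : α → ℕ, Set.InjOn e (F.scc a) :=
  Set.countable_iff_exists_injOn.1 ((hF.countable_reach a).mono fun _ hb => hb.2.2)

/-! ### Lexicographically maximal ranges -/

/-- `S` is conflict-free and its range, read as a `0`-`1` sequence along `e : α → ℕ`, is
lexicographically maximal on the arguments `x` with `e x < n`: whenever another conflict-free set
has such an `x` in its range and `S` has not, then `S` is ahead at some earlier argument. -/
def LexMaximal (G : AF α) (e : α → ℕ) (n : ℕ) (S : Set α) : Prop :=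
  S ∈ cf G ∧ ∀ C ∈ cf G, ∀ x ∈ G.range C, e x < n → x ∉ G.range S →
    ∃ y ∈ G.range S, y ∉ G.range C ∧ e y < e x

theorem LexMaximal.mono {G : AF α} {e : α → ℕ} {m n : ℕ} {S : Set α} (h : G.LexMaximal e n S)
    (hmn : m ≤ n) : G.LexMaximal e m S :=
  ⟨h.1, fun C hC x hx hxm => h.2 C hC x hx (hxm.trans_le hmn)⟩

theorem mem_stage_of_lexMaximal {G : AF α} {e : α → ℕ} {S : Set α}
    (h : ∀ n, G.LexMaximal e n S) : S ∈ stage G := by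
  refine ⟨(h 0).1, ?_⟩
  rintro ⟨T, hT, hST⟩
  obtain ⟨x, hxT, hxS⟩ := Set.exists_of_ssubset hST
  obtain ⟨y, hyS, hyT, -⟩ := (h (e x + 1)).2 T hT x hxT (Nat.lt_succ_self _) hxS
  exact hyT (hST.1 hyS)

theorem range_subset_args {G : AF α} {S : Set α} (hS : S ∈ cf G) : G.range S ⊆ G.args := by
  rintro x (hx | ⟨y, -, hyx⟩)
  · exact hS.1 hx
  · exact G.right_mem hyx

theorem exists_lexMaximal (G : AF α) {e : α → ℕ} (he : Set.InjOn e G.args) (n : ℕ) :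
    ∃ S, G.LexMaximal e n S := by
  induction n with
  | zero => exact ⟨∅, ⟨Set.empty_subset _, by simp⟩, fun _ _ _ _ h => absurd h (Nat.not_lt_zero _)⟩
  | succ n ih =>
    obtain ⟨S, hS, hmax⟩ := ih
    -- Prefer a set that keeps the range of `S` below `n` and in addition has the argument
    -- numbered `n` in its range, if there is one.
    by_cases hex : ∃ C ∈ cf G, (∀ y ∈ G.range S, e y < n → y ∈ G.range C) ∧
        ∃ x ∈ G.range C, e x = n
    · obtain ⟨C, hC, hSC, z, hz, hzn⟩ := hex
      refine ⟨C, hC, fun C' hC' x hx hxn hxC => ?_⟩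
      have hxn' : e x < n := by
        refine lt_of_le_of_ne (Nat.lt_succ_iff.1 hxn) fun hxe => hxC ?_
        rwa [he (range_subset_args hC' hx) (range_subset_args hC hz) (hxe.trans hzn.symm)]
      obtain ⟨y, hy, hyC, hyx⟩ := hmax C' hC' x hx hxn' fun hxS => hxC (hSC x hxS hxn')
      exact ⟨y, hSC y hy (hyx.trans hxn'), hyC, hyx⟩
    · refine ⟨S, hS, fun C hC x hx hxn hxS => ?_⟩
      rcases (Nat.lt_succ_iff.1 hxn).lt_or_eq with hlt | heq
      · exact hmax C hC x hx hlt hxS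
      · by_contra hno
        refine hex ⟨C, hC, fun y hy hyn => ?_, x, hx, heq⟩
        by_contra hyC
        exact hno ⟨y, hy, hyC, heq ▸ hyn⟩

/-! ### Closedness under pointwise limits -/

theorem mem_D_congr {F : AF α} {S S' X : Set α} {b : α}
    (h : ∀ a, F.att a b → (a ∈ S' ↔ a ∈ S)) : b ∈ F.D S' X ↔ b ∈ F.D S X := by
  constructor
  · rintro ⟨hb, a, ⟨ha, haX⟩, hab⟩
    exact ⟨hb, a, ⟨(h a hab).1 ha, haX⟩, hab⟩
  · rintro ⟨hb, a, ⟨ha, haX⟩, hab⟩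
    exact ⟨hb, a, ⟨(h a hab).2 ha, haX⟩, hab⟩

theorem Finitary.finite_att {F : AF α} (hF : F.Finitary) (b : α) : {a | F.att a b}.Finite := by
  by_cases hb : b ∈ F.args
  · exact (hF b hb).subset fun a ha => ⟨b, rfl, ha⟩
  · have : {a | F.att a b} = ∅ :=
      Set.eq_empty_of_forall_notMem fun a ha => hb (F.right_mem ha)
    simp [this]

theorem mem_range_restrict {F : AF α} {Y C : Set α} (hC : C ⊆ Y) {x : α} :
    x ∈ (F.restrict Y).range C ↔ x ∈ C ∨ x ∈ Y ∧ ∃ y ∈ C, F.att y x := by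
  constructor
  · rintro (hx | ⟨y, hy, hyx⟩)
    · exact .inl hx
    · exact .inr ⟨hyx.2.2, y, hy, hyx.1⟩
  · rintro (hx | ⟨hxY, y, hy, hyx⟩)
    · exact .inl hx
    · exact .inr ⟨y, hy, hyx, hC hy, hxY⟩

/-- Lexicographic maximality up to `n` on `X`, in the framework left over by `S`, passes to
pointwise limits: it suffices that on every finite set `S` agrees with some set that has it. -/
theorem lexMaximal_of_finite_agree {F : AF α} (hF : F.Finitary) {S X : Set α}
    {e : α → ℕ} (he : Set.InjOn e X) {n : ℕ}
    (h : ∀ B : Set α, B.Finite → ∃ S' : Set α, (∀ x ∈ B, (x ∈ S' ↔ x ∈ S)) ∧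
      (F.restrict (X \ F.D S' X)).LexMaximal e n (S' ∩ X)) :
    (F.restrict (X \ F.D S X)).LexMaximal e n (S ∩ X) := by
  have hcf : S ∩ X ∈ cf (F.restrict (X \ F.D S X)) := by
    have hsub : S ∩ X ⊆ F.args ∩ (X \ F.D S X) := by
      rintro a ⟨haS, haX⟩
      obtain ⟨S', hag, hS', -⟩ := h (insert a {c | F.att c a}) ((hF.finite_att a).insert a)
      have ha := hS'.1 ⟨(hag a (Set.mem_insert _ _)).2 haS, haX⟩
      exact ⟨ha.1, haX, fun hD => ha.2.2
        ((mem_D_congr fun c hc => hag c (Set.mem_insert_of_mem _ hc)).2 hD)⟩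
    refine ⟨hsub, fun a ha b hb hab => ?_⟩
    obtain ⟨S', hag, hS', -⟩ := h {a, b} (by simp)
    have ha' : a ∈ S' ∩ X := ⟨(hag a (by simp)).2 ha.1, ha.2⟩
    have hb' : b ∈ S' ∩ X := ⟨(hag b (by simp)).2 hb.1, hb.2⟩
    exact hS'.2 a ha' b hb' ⟨hab.1, (hS'.1 ha').2, (hS'.1 hb').2⟩
  refine ⟨hcf, fun C hC x hx hxn hxS => ?_⟩
  -- Only the arguments up to `x`, their attackers and the attackers of those matter.
  set A : Set α := {y ∈ X | e y ≤ e x}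
  have hA : A.Finite :=
    Set.Finite.of_finite_image ((Set.finite_Iic (e x)).subset (by rintro _ ⟨y, hy, rfl⟩; exact hy.2))
      (he.mono fun y hy => hy.1)
  set A₁ : Set α := A ∪ ⋃ y ∈ A, {z | F.att z y}
  have hA₁ : A₁.Finite := hA.union (hA.biUnion fun y _ => hF.finite_att y)
  obtain ⟨S', hag, hS', hmax⟩ := h (A₁ ∪ ⋃ y ∈ A₁, {z | F.att z y})
    (hA₁.union (hA₁.biUnion fun y _ => hF.finite_att y))
  have hag₁ : ∀ y ∈ A₁, (y ∈ S' ↔ y ∈ S) := fun y hy => hag y (.inl hy)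
  have hD : ∀ y ∈ A₁, (y ∈ F.D S' X ↔ y ∈ F.D S X) := fun y hy =>
    mem_D_congr fun z hz => hag z (.inr (Set.mem_biUnion hy hz))
  have hAA : A ⊆ A₁ := Set.subset_union_left
  have hatt : ∀ {y z}, y ∈ A → F.att z y → z ∈ A₁ := fun hy hz => .inr (Set.mem_biUnion hy hz)
  have hCsub : C ⊆ X \ F.D S X := fun y hy => (hC.1 hy).2
  have hC'sub : C ∩ A₁ ⊆ X \ F.D S' X :=
    fun y hy => ⟨(hCsub hy.1).1, fun hy' => (hCsub hy.1).2 ((hD y hy.2).1 hy')⟩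
  have hC' : C ∩ A₁ ∈ cf (F.restrict (X \ F.D S' X)) :=
    ⟨fun y hy => ⟨(hC.1 hy.1).1, hC'sub hy⟩, fun a ha b hb hab =>
      hC.2 a ha.1 b hb.1 ⟨hab.1, hCsub ha.1, hCsub hb.1⟩⟩
  have hSsub : S ∩ X ⊆ X \ F.D S X := fun y hy => (hcf.1 hy).2
  have hS'sub : S' ∩ X ⊆ X \ F.D S' X := fun y hy => (hS'.1 hy).2
  have hY : ∀ y ∈ A, (y ∈ X \ F.D S' X ↔ y ∈ X \ F.D S X) := fun y hy => by
    simp only [Set.mem_sdiff, hD y (hAA hy)]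
  have hrS : ∀ y ∈ A, (y ∈ (F.restrict (X \ F.D S' X)).range (S' ∩ X) ↔
      y ∈ (F.restrict (X \ F.D S X)).range (S ∩ X)) := fun y hy => by
    rw [mem_range_restrict hSsub, mem_range_restrict hS'sub, hY y hy]
    refine or_congr (and_congr_left' (hag₁ y (hAA hy))) (and_congr_right' (exists_congr fun z => ?_))
    exact and_congr_left fun hz => and_congr_left' (hag₁ z (hatt hy hz))
  have hrC : ∀ y ∈ A, (y ∈ (F.restrict (X \ F.D S' X)).range (C ∩ A₁) ↔
      y ∈ (F.restrict (X \ F.D S X)).range C) := fun y hy => by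
    rw [mem_range_restrict hCsub, mem_range_restrict hC'sub, hY y hy]
    refine or_congr (and_iff_left (hAA hy)) (and_congr_right' (exists_congr fun z => ?_))
    exact and_congr_left fun hz => and_iff_left (hatt hy hz)
  have hxA : x ∈ A := ⟨(range_subset_args hC hx).2.1, le_rfl⟩
  obtain ⟨y, hyS, hyC, hyx⟩ := hmax _ hC' x ((hrC x hxA).2 hx) hxn fun hx' => hxS ((hrS x hxA).1 hx')
  have hyA : y ∈ A := ⟨(range_subset_args hS' hyS).2.1, hyx.le⟩
  exact ⟨y, (hrS y hyA).1 hyS, fun hy => hyC ((hrC y hyA).2 hy), hyx⟩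

/-! ### Extending over the components outside an unattacked set -/

theorem scc_eq_of_mem {F : AF α} {a b : α} (hb : b ∈ F.scc a) : F.scc b = F.scc a := by
  ext c
  exact ⟨fun hc => ⟨hc.1, hb.2.1.trans hc.2.1, hc.2.2.trans hb.2.2⟩,
    fun hc => ⟨hc.1, hb.2.2.trans hc.2.1, hc.2.2.trans hb.2.1⟩⟩

theorem exists_reach_maximal (F : AF α) {E : Finset α} (hE : E.Nonempty) :
    ∃ a ∈ E, ∀ b ∈ E, F.Reach a b → F.Reach b a := by
  let _ : Preorder α :=
    { le := F.Reach, le_refl := fun _ => .refl, le_trans := fun _ _ _ => .trans }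
  obtain ⟨a, ha⟩ := E.exists_maximal hE
  exact ⟨a, ha.1, fun b hb hab => ha.2 hb hab⟩

/-- The requirements for finitely many components can be met simultaneously: a component that
reaches no other one of the list is treated last, and this leaves the others undisturbed. -/
theorem exists_finite_extension {F : AF α} {e : Set α → α → ℕ}
    (he : ∀ a, Set.InjOn (e (F.scc a)) (F.scc a)) {U T : Set α} (hUF : U ⊆ F.args) (hU : F.Unattacked U)
    (hT : T ⊆ U) (n : ℕ) (E : Finset α) :
    ∃ S ⊆ F.args, S ∩ U = T ∧ ∀ a ∈ E, a ∈ F.args → a ∉ U →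
      (F.restrict (F.scc a \ F.D S (F.scc a))).LexMaximal (e (F.scc a)) n
        (S ∩ F.scc a) := by
  classical
  induction E using Finset.strongInduction with
  | H E ih =>
  rcases E.eq_empty_or_nonempty with rfl | hE
  · exact ⟨T, hT.trans hUF, Set.inter_eq_left.2 hT, by simp⟩
  obtain ⟨a, haE, hmax⟩ := F.exists_reach_maximal hE
  by_cases ha : a ∈ F.args ∧ a ∉ U
  swap
  · obtain ⟨S, hSF, hSU, hS⟩ := ih (E.erase a) (Finset.erase_ssubset haE)
    refine ⟨S, hSF, hSU, fun b hb hbF hbU => hS b (Finset.mem_erase.2 ⟨?_, hb⟩) hbF hbU⟩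
    rintro rfl
    exact ha ⟨hbF, hbU⟩
  have haa : a ∈ F.scc a := ⟨ha.1, .refl, .refl⟩
  obtain ⟨S, hSF, hSU, hS⟩ := ih (E.filter (· ∉ F.scc a))
    (Finset.filter_ssubset.2 ⟨a, haE, not_not.2 haa⟩)
  obtain ⟨C, hC⟩ := exists_lexMaximal (F.restrict (F.scc a \ F.D S (F.scc a)))
    ((he a).mono fun x hx => hx.2.1) n
  have hCX : C ⊆ F.scc a := fun x hx => (hC.1.1 hx).2.1
  -- Replace the part of `S` in the component of `a` by `C`.
  refine ⟨S \ F.scc a ∪ C, ?_, ?_, fun b hb hbF hbU => ?_⟩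
  · exact Set.union_subset (Set.sdiff_subset.trans hSF) fun x hx => (hCX hx).1
  · rw [← hSU]
    ext x
    constructor
    · rintro ⟨hx | hx, hxU⟩
      · exact ⟨hx.1, hxU⟩
      · exact absurd hxU (hU.notMem_of_mem_scc ha.2 (hCX hx))
    · rintro ⟨hx, hxU⟩
      exact ⟨.inl ⟨hx, fun hxa => hU.notMem_of_mem_scc ha.2 hxa hxU⟩, hxU⟩
  by_cases hba : b ∈ F.scc a
  · rw [scc_eq_of_mem hba]
    have h1 : (S \ F.scc a ∪ C) ∩ F.scc a = C := by
      ext x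
      exact ⟨fun hx => hx.1.elim (fun h => absurd hx.2 h.2) id, fun hx => ⟨.inr hx, hCX hx⟩⟩
    have h2 : F.D (S \ F.scc a ∪ C) (F.scc a) = F.D S (F.scc a) := by
      unfold D
      congr! 6 with x y
      exact ⟨fun hy => ⟨hy.1.elim And.left fun h => absurd (hCX h) hy.2, hy.2⟩,
        fun hy => ⟨.inl ⟨hy.1, hy.2⟩, hy.2⟩⟩
    rwa [h1, h2]
  · -- No argument of the component of `a` reaches `b`, so changing `S` there has no effect.
    have hno : ∀ x ∈ F.scc a, ¬ F.Reach x b := fun x hx hxb =>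
      have hab := hx.2.1.trans hxb
      hba ⟨hbF, hab, hmax b hb hab⟩
    have hmem : ∀ x, F.Reach x b → (x ∈ S \ F.scc a ∪ C ↔ x ∈ S) := fun x hx =>
      ⟨fun h => h.elim And.left fun h => absurd hx (hno x (hCX h)),
        fun h => .inl ⟨h, fun hxa => hno x hxa hx⟩⟩
    have h1 : (S \ F.scc a ∪ C) ∩ F.scc b = S ∩ F.scc b := by
      ext x
      exact and_congr_left fun hx => hmem x hx.2.2
    have h2 : F.D (S \ F.scc a ∪ C) (F.scc b) = F.D S (F.scc b) := by
      ext x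
      by_cases hx : x ∈ F.scc b
      · exact mem_D_congr fun y hy => hmem y (.head hy hx.2.2)
      · exact iff_of_false (fun h => hx h.1) fun h => hx h.1
    rw [h1, h2]
    exact hS b (Finset.mem_filter.2 ⟨hb, hba⟩) hbF hbU

/-- Every subset `T` of an unattacked set `U` extends to a set that induces stage extensions on
all components outside `U`. -/
theorem exists_extension {F : AF α} (hF : F.Finitary) {U T : Set α} (hUF : U ⊆ F.args)
    (hU : F.Unattacked U) (hT : T ⊆ U) :
    ∃ S ⊆ F.args, S ∩ U = T ∧ ∀ a ∈ F.args, a ∉ U →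
      S ∩ F.scc a ∈ stage (F.restrict (F.scc a \ F.D S (F.scc a))) := by
  -- The enumeration is chosen per component, not per argument: equal components must share it.
  have hinj : ∀ X : Set α, ∃ e : α → ℕ, ∀ a, X = F.scc a → Set.InjOn e X := fun X => by
    by_cases hX : ∃ a, X = F.scc a
    · obtain ⟨a, rfl⟩ := hX
      obtain ⟨e, he⟩ := hF.exists_injOn_scc a
      exact ⟨e, fun _ _ => he⟩
    · exact ⟨fun _ => 0, fun a ha => absurd ⟨a, ha⟩ hX⟩
  choose e he' using hinj
  have he : ∀ a, Set.InjOn (e (F.scc a)) (F.scc a) := fun a => he' _ a rfl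
  classical
  choose S hSF hSU hS using fun i : Finset α × ℕ => exists_finite_extension he hUF hU hT i.2 i.1
  let l : Ultrafilter (Finset α × ℕ) := Ultrafilter.of Filter.atTop
  have hl : (l : Filter (Finset α × ℕ)) ≤ Filter.atTop := Ultrafilter.of_le _
  set L : Set α := {x | ∀ᶠ i in (l : Filter _), x ∈ S i}
  have hag : ∀ x, ∀ᶠ i in (l : Filter _), (x ∈ S i ↔ x ∈ L) := fun x => by
    by_cases hx : x ∈ L
    · exact Filter.Eventually.mono (show ∀ᶠ i in (l : Filter _), x ∈ S i from hx)
        fun i hi => iff_of_true hi hx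
    · exact (Ultrafilter.eventually_not.2 hx).mono fun i hi => iff_of_false hi hx
  refine ⟨L, fun x hx => ?_, ?_, fun a ha haU => mem_stage_of_lexMaximal (e := e (F.scc a)) fun n => ?_⟩
  · obtain ⟨i, hi⟩ := Filter.Eventually.exists (show ∀ᶠ i in (l : Filter _), x ∈ S i from hx)
    exact hSF i hi
  · ext x
    obtain ⟨i, hi⟩ := (hag x).exists
    rw [← hSU i, Set.mem_inter_iff, Set.mem_inter_iff, hi]
  · refine lexMaximal_of_finite_agree hF (he a) fun B hB => ?_
    have h1 : ∀ᶠ i in (l : Filter _), ∀ x ∈ B, (x ∈ S i ↔ x ∈ L) :=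
      (Filter.eventually_all_finite hB).2 fun x _ => hag x
    have h2 : ∀ᶠ i in (l : Filter _), (({a}, n) : Finset α × ℕ) ≤ i :=
      hl (Filter.eventually_ge_atTop _)
    obtain ⟨i, hi, han⟩ := (h1.and h2).exists
    exact ⟨S i, hi, (hS i a (Finset.singleton_subset_iff.1 han.1) ha haU).mono han.2⟩

/-! ### Directionality -/

theorem stage_subset_naive (G : AF α) : stage G ⊆ naive G := by
  rintro S ⟨hS, hmax⟩
  refine ⟨hS, ?_⟩
  rintro ⟨T, hT, hST⟩
  have hr : G.range S ⊆ G.range T :=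
    Set.union_subset_union hST.1 fun x ⟨y, hy, hyx⟩ => ⟨y, hST.1 hy, hyx⟩
  obtain ⟨x, hxT, hxS⟩ := Set.exists_of_ssubset hST
  refine hmax ⟨T, hT, hr, fun hTS => ?_⟩
  rcases hTS (.inl hxT) with hx | ⟨y, hy, hyx⟩
  · exact hxS hx
  · exact hT.2 y (hST.1 hy) x hxT hyx

/-- Directionality for the semantics that imposes `τ` on every component, for any semantics `τ`
that contains all stage extensions and consists of conflict-free sets. -/
theorem directionality_of_stage_subset (τ : AF α → Set (Set α)) (hτ : ∀ G, stage G ⊆ τ G)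
    (hτcf : ∀ G, τ G ⊆ cf G) {F : AF α} (hF : F.Finitary) {U : Set α} (hUF : U ⊆ F.args)
    (hU : F.Unattacked U) :
    {T | T ∈ cf (F.restrict U) ∧ ∀ X ∈ (F.restrict U).SCCs,
      T ∩ X ∈ τ ((F.restrict U).restrict (X \ (F.restrict U).D T X))} =
    {T | ∃ S ∈ {S | S ∈ cf F ∧ ∀ X ∈ F.SCCs, S ∩ X ∈ τ (F.restrict (X \ F.D S X))},
      T = S ∩ U} := by
  -- On a component inside `U` the two conditions are literally the same.
  have key : ∀ S : Set α, ∀ a ∈ U,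
      ((S ∩ U) ∩ (F.restrict U).scc a ∈ τ ((F.restrict U).restrict
        ((F.restrict U).scc a \ (F.restrict U).D (S ∩ U) ((F.restrict U).scc a))) ↔
      S ∩ F.scc a ∈ τ (F.restrict (F.scc a \ F.D S (F.scc a)))) := by
    intro S a ha
    rw [hU.scc_restrict ha, hU.D_restrict S (hU.scc_subset ha),
      F.restrict_restrict (Set.sdiff_subset.trans (hU.scc_subset ha)), Set.inter_assoc,
      Set.inter_eq_right.2 (hU.scc_subset ha)]
  ext T
  constructor
  · rintro ⟨hT, hTX⟩
    obtain ⟨S, hSF, rfl, hS⟩ := exists_extension hF hUF hU fun x hx => (hT.1 hx).2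
    have hX : ∀ a ∈ F.args, S ∩ F.scc a ∈ τ (F.restrict (F.scc a \ F.D S (F.scc a))) := by
      intro a ha
      by_cases haU : a ∈ U
      · exact (key S a haU).1 (hTX _ ⟨a, ⟨ha, haU⟩, rfl⟩)
      · exact hτ _ (hS a ha haU)
    refine ⟨S, ⟨⟨hSF, fun a ha b hb hab => ?_⟩, ?_⟩, rfl⟩
    · -- An attack within `S` would stay in the component of its target `b`, as `b` is not in
      -- the part of that component which is attacked from outside.
      have hcf := hτcf _ (hX b (hSF hb))
      have hbS : b ∈ S ∩ F.scc b := ⟨hb, hSF hb, .refl, .refl⟩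
      have hbD := (hcf.1 hbS).2
      have haX : a ∈ F.scc b := by
        by_contra haX
        exact hbD.2 ⟨hbS.2, a, ⟨ha, haX⟩, hab⟩
      exact hcf.2 a ⟨ha, haX⟩ b hbS ⟨hab, (hcf.1 ⟨ha, haX⟩).2, hbD⟩
    · rintro X ⟨a, ha, rfl⟩
      exact hX a ha
  · rintro ⟨S, ⟨hS, hSX⟩, rfl⟩
    refine ⟨⟨fun x hx => ⟨hS.1 hx.1, hx.2⟩, fun a ha b hb hab => hS.2 a ha.1 b hb.1 hab.1⟩, ?_⟩
    rintro X ⟨a, ha, rfl⟩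
    exact (key S a ha.2).2 (hSX _ ⟨a, ha.1, rfl⟩)

end AF

theorem mainTheorem3 :
    FinitaryDirectionality.{u} cf15 ∧ FinitaryDirectionality.{u} stg15 := by
  constructor
  · intro α F hF U hUF hU
    exact AF.directionality_of_stage_subset naive AF.stage_subset_naive (fun _ _ h => h.1) hF hUF hU
  · intro α F hF U hUF hU
    exact AF.directionality_of_stage_subset stage (fun _ => subset_rfl) (fun _ _ h => h.1) hF hUF hU
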